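/- For $A\subseteq\mathbb Z/N\mathbb Z$ put $\widehat{1_A}(r)=\sum_{x\in A}e^{-2\pi i xr/N}$ and, for $\theta\ge 0$, $\Delta_\theta=\{r\in\mathbb Z/N\mathbb Z:\ |\widehat{1_A}(r)|\ge\theta|A|\}$. Let $E_8(S)$ be the number of $(a_1,\dots,a_4,b_1,\dots,b_4)\in S^8$ with $a_1+\dots+a_4=b_1+\dots+b_4$. For $\Gamma\subseteq\mathbb Z/N\mathbb Z$ and real $\gamma$ let $B(\Gamma,\gamma)=\{x\in\mathbb Z/N\mathbb Z:\ \|tx/N\|\le\gamma\text{ for all }t\in\Gamma\}$, where $\|\cdot\|$ is the distance to the nearest integer; for $\gamma\in(0,\frac12]$ this is the Bohr set of rank $|\Gamma|$ and radius $\gamma$. It is called regular if $(1-100|\Gamma||\eta|)|B(\Gamma,\gamma)|\le|B(\Gamma,(1+\eta)\gamma)|\le(1+100|\Gamma||\eta|)|B(\Gamma,\gamma)|$ for all real $\eta$ with $100|\Gamma||\eta|\le1$. There are absolute constants $\mu_0,C,c>0$ such that the following holds. Let $0<\mu\le\mu_0$, let $N\ge1$, let $A\subseteq\mathbb Z/N\mathbb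 Z$ be non-empty with $|A|=\delta N$, and assume that $\delta^{\mu/20}\log(1/\delta)<1$. Suppose that for some $\theta$ with $\delta^{1+\mu}\le\theta\le\delta^{1-\mu}$ we have $$|\Delta_\theta|\ge\delta^{2\mu}\theta^{-2}\delta^{-1}\qquad\text{and}\qquad E_8(\Delta_\theta)\ge\delta^{-20\mu}\theta^8\delta|\Delta_\theta|^8 .$$ Then there are $\Gamma\subseteq\mathbb Z/N\mathbb Z$ and $\gamma\in(0,\frac12]$ such that the Bohr set $B=B(\Gamma,\gamma)$ is regular, has rank $|\Gamma|\le C\delta^{-1+\mu/2}$ and radius $\gamma\ge c\,\delta^{1-\mu/2}$, and for some $t\in\mathbb Z/N\mathbb Z$ $$|(A+t)\cap B|\ge c\,\delta^{1-\mu/2}|B| .$$ -/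

import Mathlib

open Finset

noncomputable section

/-- The `θ`-spectrum of `A ⊆ ℤ/Nℤ`: all `r` with `|∑_{x ∈ A} e^{-2πixr/N}| ≥ θ|A|`. -/
def largeSpectrum {N : ℕ} [NeZero N] (A : Finset (ZMod N)) (θ : ℝ) : Finset (ZMod N) :=
  univ.filter fun r =>
    θ * (#A : ℝ) ≤ ‖ZMod.dft (fun x : ZMod N => if x ∈ A then (1 : ℂ) else 0) r‖

/-- The energy `E_{2m}(S)`: the number of `(a₁, …, aₘ, b₁, …, bₘ) ∈ S^{2m}` with
`a₁ + ⋯ + aₘ = b₁ + ⋯ + bₘ`. -/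
def higherEnergy {N : ℕ} (m : ℕ) (S : Finset (ZMod N)) : ℕ :=
  #(((Fintype.piFinset fun _ : Fin m => S) ×ˢ (Fintype.piFinset fun _ : Fin m => S)).filter
    fun p => ∑ i, p.1 i = ∑ i, p.2 i)

/-- The Bohr set `B(Γ, γ) = {x : ‖tx/N‖ ≤ γ for all t ∈ Γ}`. The norm on `ℝ/ℤ` is the distance to
the nearest integer, and `ZMod.toAddCircle` sends `j` to `j/N`. The size of `Γ` is the rank. -/
def bohrSet {N : ℕ} [NeZero N] (Γ : Finset (ZMod N)) (γ : ℝ) : Finset (ZMod N) :=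
  univ.filter fun x => ∀ t ∈ Γ, ‖ZMod.toAddCircle (t * x)‖ ≤ γ

/-- Regularity of the Bohr set `B(Γ, γ)`: for all `η` with `|η| ≤ 1/(100|Γ|)`,
`(1 - 100|Γ||η|)|B(Γ, γ)| ≤ |B(Γ, (1+η)γ)| ≤ (1 + 100|Γ||η|)|B(Γ, γ)|`. -/
def IsRegularBohr {N : ℕ} [NeZero N] (Γ : Finset (ZMod N)) (γ : ℝ) : Prop :=
  ∀ η : ℝ, 100 * (#Γ : ℝ) * |η| ≤ 1 →
    (1 - 100 * (#Γ : ℝ) * |η|) * (#(bohrSet Γ γ) : ℝ) ≤ (#(bohrSet Γ ((1 + η) * γ)) : ℝ) ∧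
    (#(bohrSet Γ ((1 + η) * γ)) : ℝ) ≤ (1 + 100 * (#Γ : ℝ) * |η|) * (#(bohrSet Γ γ) : ℝ)

end

/-! Write `Δ` for the large spectrum. Its eighth energy is the normalized eighth moment of its
exponential sum, so large energy forces that sum to exceed `κ|Δ|`, `κ ≈ δ^(1-2μ)`, on a set of
density `α ≈ δ^9` (`card_large_expSum`). This produces additive dependence
(`exists_list_signedSum`): if every list of fewer than `d` elements of `R` had few elements of `R`
among its signed sums, Riesz products over elements of `R` would keep the `d`-th moment of `1 + Re(σ
· expSum R)/|R|` too small for such a large level set. So some list of fewer than `d ≈ log(1/α)/κ`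
elements captures a proportion `κ/8` of `R`.

Removing captured elements leaves a set whose energy is still large until `s` of them are collected
(`exists_small_spanning_set`). This takes `n ≈ δ^(-μ/2)` rounds, so `nd` frequencies suffice, while
each captured element uses only one round's list. Hence radius about `1/d`, rather than `1/(nd)`,
already makes the exponential sum of the Bohr set `B` at least `|B|/2` at all captured frequencies.
These lie in the spectrum of `A`, so by Parseval the counts `|(A+t) ∩ B|` have large `L²` norm,
hence a large maximum (`exists_dense_translate`). The radius is made regular by a Vitali covering
argument. -/

/-- The exponential sum `∑_{x ∈ S} e^{2πixy/N}`. -/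
noncomputable def expSum {N : ℕ} [NeZero N] (S : Finset (ZMod N)) (y : ZMod N) : ℂ :=
  ∑ x ∈ S, ZMod.stdAddChar (x * y)

/-! ### Fourier analysis on `ZMod N` and energies -/

section Fourier

variable {N : ℕ} [NeZero N]

lemma norm_stdAddChar (x : ZMod N) : ‖ZMod.stdAddChar x‖ = 1 := by
  exact AddChar.norm_apply _ x

lemma conj_stdAddChar (x : ZMod N) :
    (starRingEnd ℂ) (ZMod.stdAddChar x) = ZMod.stdAddChar (-x) := by
  rw [AddChar.map_neg_eq_inv, Complex.inv_eq_conj (norm_stdAddChar x)]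

lemma sum_stdAddChar_mul (x : ZMod N) :
    ∑ y : ZMod N, ZMod.stdAddChar (x * y) = if x = 0 then (N : ℂ) else 0 := by
  have h := AddChar.sum_mulShift x (ZMod.isPrimitive_stdAddChar N)
  simp only [mul_comm _ x, ZMod.card] at h
  rw [h]; split_ifs <;> simp

lemma parseval_zmod (g : ZMod N → ℂ) :
    ∑ r : ZMod N, ‖∑ x, g x * ZMod.stdAddChar (x * r)‖ ^ 2 = N * ∑ x, ‖g x‖ ^ 2 := by
  have key : ∀ r : ZMod N, ((‖∑ x, g x * ZMod.stdAddChar (x * r)‖ ^ 2 : ℝ) : ℂ) =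
      ∑ x, ∑ y, g x * (starRingEnd ℂ) (g y) * ZMod.stdAddChar ((x - y) * r) := by
    intro r
    push_cast
    rw [← Complex.mul_conj', map_sum, sum_mul_sum]
    refine sum_congr rfl fun x _ => sum_congr rfl fun y _ => ?_
    rw [RingHom.map_mul, conj_stdAddChar, sub_mul, sub_eq_add_neg (x * r), AddChar.map_add_eq_mul]
    ring
  have : ((∑ r : ZMod N, ‖∑ x, g x * ZMod.stdAddChar (x * r)‖ ^ 2 : ℝ) : ℂ)
      = ((N * ∑ x, ‖g x‖ ^ 2 : ℝ) : ℂ) := by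
    rw [Complex.ofReal_sum, sum_congr rfl fun r _ => key r, sum_comm]
    push_cast
    rw [mul_sum]
    refine sum_congr rfl fun x _ => ?_
    rw [sum_comm]
    simp_rw [← mul_sum, sum_stdAddChar_mul, sub_eq_zero]
    rw [Finset.sum_eq_single x]
    · rw [if_pos rfl, Complex.mul_conj']; ring
    · intro b _ hb; rw [if_neg hb.symm, mul_zero]
    · simp
  exact_mod_cast this

lemma norm_expSum_le (S : Finset (ZMod N)) (y : ZMod N) : ‖expSum S y‖ ≤ #S := by
  refine (norm_sum_le _ _).trans ?_
  simp

lemma expSum_eq_sum_indicator (S : Finset (ZMod N)) (y : ZMod N) :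
    expSum S y = ∑ x, (if x ∈ S then (1 : ℂ) else 0) * ZMod.stdAddChar (x * y) := by
  simp [expSum]

lemma sum_norm_expSum_sq (S : Finset (ZMod N)) :
    ∑ y, ‖expSum S y‖ ^ 2 = N * (#S : ℝ) := by
  simp_rw [expSum_eq_sum_indicator]
  rw [parseval_zmod]
  congr 1
  rw [← sum_filter_add_sum_filter_not univ (fun x => x ∈ S)]
  rw [sum_congr rfl (g := fun _ => (1 : ℝ)) (by intro x hx; simp at hx; simp [hx])]
  rw [sum_congr (s₁ := filter (fun x => x ∉ S) univ) rfl (g := fun _ => (0 : ℝ))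
    (by intro x hx; simp at hx; simp [hx])]
  simp

lemma norm_dft_indicator (A : Finset (ZMod N)) (r : ZMod N) :
    ‖ZMod.dft (fun x : ZMod N => if x ∈ A then (1 : ℂ) else 0) r‖ = ‖expSum A r‖ := by
  rw [← RCLike.norm_conj (expSum A r), ZMod.dft_apply, expSum, map_sum]
  simp [conj_stdAddChar]

lemma mem_largeSpectrum {A : Finset (ZMod N)} {θ : ℝ} {r : ZMod N} :
    r ∈ largeSpectrum A θ ↔ θ * #A ≤ ‖expSum A r‖ := by
  simp [largeSpectrum, norm_dft_indicator]

lemma sum_mul_stdAddChar_fiber {ι : Type*} (P : Finset ι) (f : ι → ZMod N) (r : ZMod N) :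
    ∑ t, ((#(P.filter fun p => f p = t) : ℕ) : ℂ) * ZMod.stdAddChar (t * r) =
      ∑ p ∈ P, ZMod.stdAddChar (f p * r) := by
  rw [← sum_fiberwise P f]
  refine sum_congr rfl fun t _ => ?_
  rw [sum_congr rfl (g := fun _ => ZMod.stdAddChar (t * r))]
  · simp
  · intro p hp; rw [(mem_filter.1 hp).2]

lemma sum_card_fiber_sq {ι : Type*} [DecidableEq ι] (P : Finset ι) (f : ι → ZMod N) :
    ∑ t, (#(P.filter fun p => f p = t)) ^ 2 = #((P ×ˢ P).filter fun p => f p.1 = f p.2) := by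
  rw [card_eq_sum_card_fiberwise (f := fun p => f p.1) (t := univ) (by simp)]
  refine sum_congr rfl fun t _ => ?_
  rw [sq, ← card_product]
  congr 1
  ext ⟨p, q⟩
  simp only [mem_product, mem_filter]
  constructor
  · rintro ⟨⟨h1, h2⟩, h3, h4⟩; exact ⟨⟨⟨h1, h3⟩, h2.trans h4.symm⟩, h2⟩
  · rintro ⟨⟨⟨h1, h3⟩, h2⟩, h4⟩; exact ⟨⟨h1, h4⟩, h3, h2.symm.trans h4⟩

lemma stdAddChar_sum {ι : Type*} (s : Finset ι) (f : ι → ZMod N) :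
    ZMod.stdAddChar (∑ i ∈ s, f i) = ∏ i ∈ s, (ZMod.stdAddChar (f i) : ℂ) := by
  classical
  induction s using Finset.induction_on with
  | empty => simp
  | insert a s ha ih => rw [sum_insert ha, prod_insert ha, AddChar.map_add_eq_mul, ih]

lemma sum_norm_expSum_pow (S : Finset (ZMod N)) (m : ℕ) :
    ∑ y, ‖expSum S y‖ ^ (2 * m) = N * (higherEnergy m S : ℝ) := by
  have h1 : ∀ y : ZMod N, (expSum S y) ^ m =
      ∑ t, ((#((Fintype.piFinset fun _ : Fin m => S).filter fun p => ∑ i, p i = t) : ℕ) : ℂ)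
        * ZMod.stdAddChar (t * y) := by
    intro y
    rw [sum_mul_stdAddChar_fiber, expSum]
    have := (prod_univ_sum (fun _ : Fin m => S) (fun _ x => ZMod.stdAddChar (x * y)) :
      (∏ _i : Fin m, ∑ x ∈ S, (ZMod.stdAddChar (x * y) : ℂ)) = _)
    rw [prod_const, card_univ, Fintype.card_fin] at this
    rw [this]
    refine sum_congr rfl fun p _ => ?_
    rw [sum_mul, stdAddChar_sum]
  calc ∑ y, ‖expSum S y‖ ^ (2 * m) = ∑ y, ‖(expSum S y) ^ m‖ ^ 2 :=
        sum_congr rfl fun y _ => by rw [norm_pow, ← pow_mul, mul_comm]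
    _ = _ := by
      rw [sum_congr rfl fun y _ => by rw [h1 y], parseval_zmod, higherEnergy,
        ← sum_card_fiber_sq]
      simp

lemma expSum_sdiff {S U : Finset (ZMod N)} (h : U ⊆ S) (y : ZMod N) :
    expSum S y = expSum (S \ U) y + expSum U y := by
  rw [expSum, expSum, expSum, sum_sdiff h]

lemma add_pow_eight_le (a b : ℝ) (ha : 0 ≤ a) (hb : 0 ≤ b) :
    (a + b) ^ 8 ≤ 2 ^ 7 * (a ^ 8 + b ^ 8) := add_pow_le ha hb 8

/-- Energy is an eighth moment, so convexity of `x ^ 8` costs only `2 ^ 7`. Deleting a subset of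
small energy therefore preserves large energy. -/
lemma higherEnergy_four_le_sdiff {S U : Finset (ZMod N)} (h : U ⊆ S) :
    (higherEnergy 4 S : ℝ) ≤ 2 ^ 7 * (higherEnergy 4 (S \ U) + higherEnergy 4 U) := by
  have hN : (0 : ℝ) < N := by exact_mod_cast NeZero.pos N
  refine le_of_mul_le_mul_left ?_ hN
  have h1 := sum_norm_expSum_pow S 4
  have h2 := sum_norm_expSum_pow (S \ U) 4
  have h3 := sum_norm_expSum_pow U 4
  calc (N : ℝ) * higherEnergy 4 S = ∑ y, ‖expSum S y‖ ^ (2 * 4) := h1.symm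
    _ ≤ ∑ y, 2 ^ 7 * (‖expSum (S \ U) y‖ ^ (2 * 4) + ‖expSum U y‖ ^ (2 * 4)) := by
        refine sum_le_sum fun y _ => ?_
        rw [expSum_sdiff h]
        exact (pow_le_pow_left₀ (norm_nonneg _) (norm_add_le _ _) 8).trans
          (add_pow_eight_le _ _ (norm_nonneg _) (norm_nonneg _))
    _ = _ := by rw [← mul_sum, sum_add_distrib, h2, h3]; ring

lemma higherEnergy_four_le_card_pow (U : Finset (ZMod N)) :
    (higherEnergy 4 U : ℝ) ≤ (#U : ℝ) ^ 7 := by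
  have hN : (0 : ℝ) < N := by exact_mod_cast NeZero.pos N
  refine le_of_mul_le_mul_left ?_ hN
  calc (N : ℝ) * higherEnergy 4 U = ∑ y, ‖expSum U y‖ ^ (2 * 4) := (sum_norm_expSum_pow U 4).symm
    _ ≤ ∑ y, (#U : ℝ) ^ 6 * ‖expSum U y‖ ^ 2 := by
        refine sum_le_sum fun y _ => ?_
        rw [show 2 * 4 = 6 + 2 from rfl, pow_add]
        gcongr
        exact norm_expSum_le U y
    _ = _ := by rw [← mul_sum, sum_norm_expSum_sq]; ring

/-- A set of large eighth energy has an exponential sum that is large on a set of given density. -/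
lemma card_large_expSum {R : Finset (ZMod N)} {κ α : ℝ} (hR : R.Nonempty)
    (h1 : 2 * κ ^ 6 * (#R : ℝ) ^ 7 ≤ higherEnergy 4 R)
    (h2 : 2 * α * (#R : ℝ) ^ 8 ≤ higherEnergy 4 R) :
    α * N ≤ #(univ.filter fun y => κ * #R ≤ ‖expSum R y‖) := by
  have hN : (0 : ℝ) < N := by exact_mod_cast NeZero.pos N
  have hR' : (0 : ℝ) < #R := by exact_mod_cast hR.card_pos
  set Y := univ.filter fun y => κ * #R ≤ ‖expSum R y‖
  -- Off `Y` six of the eight factors are bounded by `κ|R|` and Parseval handles the other two. By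
  -- `h1` this part is at most half the energy, so `Y` carries the rest.
  have hb : ∀ y, ‖expSum R y‖ ^ (2 * 4) ≤
      (κ * #R) ^ 6 * ‖expSum R y‖ ^ 2 + if y ∈ Y then (#R : ℝ) ^ 8 else 0 := by
    intro y
    by_cases hy : y ∈ Y
    · rw [if_pos hy]
      have : ‖expSum R y‖ ^ (2 * 4) ≤ (#R : ℝ) ^ 8 :=
        pow_le_pow_left₀ (norm_nonneg _) (norm_expSum_le R y) 8
      have : 0 ≤ (κ * #R) ^ 6 * ‖expSum R y‖ ^ 2 := by positivity
      linarith
    · rw [if_neg hy, add_zero, show 2 * 4 = 6 + 2 from rfl, pow_add]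
      have : ‖expSum R y‖ ≤ κ * #R := by
        by_contra! hc
        exact hy (mem_filter.2 ⟨mem_univ _, hc.le⟩)
      gcongr
  have hs := sum_le_sum fun y (_ : y ∈ (univ : Finset (ZMod N))) => hb y
  rw [sum_norm_expSum_pow, sum_add_distrib, ← mul_sum, sum_norm_expSum_sq] at hs
  have hY : ∑ y, (if y ∈ Y then (#R : ℝ) ^ 8 else 0) = #Y * (#R : ℝ) ^ 8 := by
    rw [sum_ite_mem, univ_inter, sum_const, nsmul_eq_mul]
  rw [hY] at hs
  have h3 : N * (2 * κ ^ 6 * (#R : ℝ) ^ 7) ≤ N * higherEnergy 4 R := by gcongr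
  have h4 : N * (2 * α * (#R : ℝ) ^ 8) ≤ N * higherEnergy 4 R := by gcongr
  have : α * N * (#R : ℝ) ^ 8 ≤ #Y * (#R : ℝ) ^ 8 := by nlinarith
  exact le_of_mul_le_mul_right this (by positivity)

end Fourier

/-! ### Riesz products and signed sums -/

/-- `x` is a sum of distinct entries of the list, each taken with a sign. -/
def IsSignedSum {G : Type*} [AddCommGroup G] : List G → G → Prop
  | [], x => x = 0
  | a :: l, x => IsSignedSum l x ∨ IsSignedSum l (x + a) ∨ IsSignedSum l (x - a)

/-- The Riesz product `∏ (1 + Re (σ e^{2πiay/N}))` over the entries `a` of a list. -/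
noncomputable def rieszProduct {N : ℕ} [NeZero N] (σ : ℂ) (l : List (ZMod N)) (y : ZMod N) : ℝ :=
  (l.map fun a => 1 + (σ * ZMod.stdAddChar (a * y)).re).prod

section Riesz

variable {N : ℕ} [NeZero N]

lemma rieszProduct_cons (σ : ℂ) (a : ZMod N) (l : List (ZMod N)) (y : ZMod N) :
    rieszProduct σ (a :: l) y
      = (1 + (σ * ZMod.stdAddChar (a * y)).re) * rieszProduct σ l y := by
  simp [rieszProduct]

lemma one_add_re_nonneg {z : ℂ} (h : ‖z‖ ≤ 1) : 0 ≤ 1 + z.re := by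
  linarith [(abs_le.1 (Complex.abs_re_le_norm z)).1]

lemma rieszProduct_nonneg {σ : ℂ} (hσ : ‖σ‖ = 1) (l : List (ZMod N)) (y : ZMod N) :
    0 ≤ rieszProduct σ l y := by
  induction l with
  | nil => simp [rieszProduct]
  | cons a l ih =>
    rw [rieszProduct_cons]
    refine mul_nonneg (one_add_re_nonneg ?_) ih
    rw [norm_mul, hσ, norm_stdAddChar, one_mul]

/-- A factor is `1 + (σ/2)e(ay) + (σ̄/2)e(-ay)`, so the coefficient at `x` combines the shorter
product's coefficients at `x`, `x + a` and `x - a`: the recursion of `IsSignedSum`. -/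
lemma isSignedSum_of_fourier_ne_zero (σ : ℂ) (l : List (ZMod N)) (x : ZMod N)
    (h : ∑ y, (rieszProduct σ l y : ℂ) * ZMod.stdAddChar (x * y) ≠ 0) : IsSignedSum l x := by
  induction l generalizing x with
  | nil =>
    by_contra hx
    apply h
    simp only [IsSignedSum] at hx
    simp [rieszProduct, sum_stdAddChar_mul, hx]
  | cons a l ih =>
    by_contra hx
    apply h
    simp only [IsSignedSum, not_or] at hx
    have h1 := not_not.1 (mt (ih x) hx.1)
    have h2 := not_not.1 (mt (ih (x + a)) hx.2.1)
    have h3 := not_not.1 (mt (ih (x - a)) hx.2.2)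
    have : ∀ y : ZMod N, (rieszProduct σ (a :: l) y : ℂ) * ZMod.stdAddChar (x * y) =
        (rieszProduct σ l y : ℂ) * ZMod.stdAddChar (x * y)
        + σ / 2 * ((rieszProduct σ l y : ℂ) * ZMod.stdAddChar ((x + a) * y))
        + (starRingEnd ℂ) σ / 2 * ((rieszProduct σ l y : ℂ) * ZMod.stdAddChar ((x - a) * y)) := by
      intro y
      rw [rieszProduct_cons]
      push_cast
      rw [Complex.re_eq_add_conj, RingHom.map_mul, conj_stdAddChar, add_mul x, sub_mul x,
        sub_eq_add_neg, AddChar.map_add_eq_mul, AddChar.map_add_eq_mul]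
      ring
    rw [sum_congr rfl fun y _ => this y, sum_add_distrib, sum_add_distrib, ← mul_sum, ← mul_sum,
      h1, h2, h3]
    simp

open Classical in
/-- If few elements of `R` are signed sums of short lists from `R`, then high moments of the
normalized exponential sum of `R` are small. -/
lemma sum_rieszProduct_mul_pow_le {σ : ℂ} (hσ : ‖σ‖ = 1) {R : Finset (ZMod N)} (hR : R.Nonempty)
    {ς : ℝ} (hς : 0 ≤ ς) {d : ℕ}
    (hspan : ∀ l : List (ZMod N), l.length < d → (∀ a ∈ l, a ∈ R) →
      (#(R.filter fun x => IsSignedSum l x) : ℝ) ≤ ς * #R)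
    (k : ℕ) (l : List (ZMod N)) (hl : l.length + k ≤ d) (hlR : ∀ a ∈ l, a ∈ R) :
    ∑ y, rieszProduct σ l y * (1 + (σ * expSum R y).re / #R) ^ k
      ≤ (1 + ς) ^ k * ∑ y, rieszProduct σ l y := by
  have hR' : (0 : ℝ) < #R := by exact_mod_cast hR.card_pos
  -- Averaging a new factor over `x ∈ R` gives exactly one factor of the power; thus powers are
  -- traded for longer lists.
  have havg : ∀ (l : List (ZMod N)) (y : ZMod N), ∑ x ∈ R, rieszProduct σ (x :: l) y =
      #R * (rieszProduct σ l y * (1 + (σ * expSum R y).re / #R)) := by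
    intro l y
    simp_rw [rieszProduct_cons, ← sum_mul]
    rw [sum_add_distrib, expSum, mul_sum, Complex.re_sum]
    simp
    field_simp
  induction k generalizing l with
  | zero => simp
  | succ k ih =>
    -- Since the Riesz product is nonnegative, its Fourier coefficients are at most its total mass
    -- `W`. They vanish off the signed sums of `l`, of which `R` contains at most `ς|R|`.
    have hstep : ∑ y, rieszProduct σ l y * (1 + (σ * expSum R y).re / #R)
        ≤ (1 + ς) * ∑ y, rieszProduct σ l y := by
      set W := ∑ y, rieszProduct σ l y
      have hW : 0 ≤ W := sum_nonneg fun y _ => rieszProduct_nonneg hσ l y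
      have hF : ∀ x : ZMod N, (σ * ∑ y, (rieszProduct σ l y : ℂ) * ZMod.stdAddChar (x * y)).re
          ≤ if IsSignedSum l x then W else 0 := by
        intro x
        split_ifs with hx
        · refine (Complex.re_le_norm _).trans ?_
          rw [norm_mul, hσ, one_mul]
          refine (norm_sum_le _ _).trans (le_of_eq (sum_congr rfl fun y _ => ?_))
          rw [norm_mul, norm_stdAddChar, mul_one, Complex.norm_real, Real.norm_eq_abs,
            abs_of_nonneg (rieszProduct_nonneg hσ l y)]
        · rw [not_not.1 (mt (isSignedSum_of_fourier_ne_zero σ l x) hx)]; simp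
      have h1 : ∑ y, rieszProduct σ l y * (σ * expSum R y).re =
          ∑ x ∈ R, (σ * ∑ y, (rieszProduct σ l y : ℂ) * ZMod.stdAddChar (x * y)).re := by
        simp_rw [expSum, mul_sum, Complex.re_sum]
        rw [sum_comm]
        refine sum_congr rfl fun y _ => ?_
        rw [mul_sum]
        refine sum_congr rfl fun x _ => ?_
        rw [mul_left_comm, Complex.re_ofReal_mul]
      have h2 : ∑ y, rieszProduct σ l y * (σ * expSum R y).re ≤ ς * #R * W := by
        rw [h1]
        refine (sum_le_sum fun x _ => hF x).trans ?_
        rw [← sum_filter, sum_const, nsmul_eq_mul]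
        exact mul_le_mul_of_nonneg_right (hspan l (by omega) hlR) hW
      have h3 : ∑ y, rieszProduct σ l y * (1 + (σ * expSum R y).re / #R) =
          W + (∑ y, rieszProduct σ l y * (σ * expSum R y).re) / #R := by
        rw [sum_div, ← sum_add_distrib]
        exact sum_congr rfl fun y _ => by ring
      rw [h3, add_mul, one_mul]
      gcongr
      rw [div_le_iff₀ hR']
      linarith
    have h4 : #R * ∑ y, rieszProduct σ l y * (1 + (σ * expSum R y).re / #R) ^ (k + 1)
        = ∑ x ∈ R, ∑ y, rieszProduct σ (x :: l) y * (1 + (σ * expSum R y).re / #R) ^ k := by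
      rw [sum_comm, mul_sum]
      refine sum_congr rfl fun y _ => ?_
      rw [← sum_mul, havg]; ring
    have h5 : ∑ x ∈ R, ∑ y, rieszProduct σ (x :: l) y =
        #R * ∑ y, rieszProduct σ l y * (1 + (σ * expSum R y).re / #R) := by
      rw [sum_comm, mul_sum]
      exact sum_congr rfl fun y _ => havg l y
    refine le_of_mul_le_mul_left ?_ hR'
    rw [h4]
    calc _ ≤ ∑ x ∈ R, (1 + ς) ^ k * ∑ y, rieszProduct σ (x :: l) y := by
          refine sum_le_sum fun x hx => ih (x :: l) (by simp; omega) ?_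
          simpa using ⟨hx, hlR⟩
      _ = (1 + ς) ^ k * (#R * ∑ y, rieszProduct σ l y * (1 + (σ * expSum R y).re / #R)) := by
          rw [← mul_sum, h5]
      _ ≤ (1 + ς) ^ k * (#R * ((1 + ς) * ∑ y, rieszProduct σ l y)) := by gcongr
      _ = _ := by ring

/-- Riesz products see only real parts; four rotations `σ` recover the norm up to a factor 2. -/
lemma norm_div_two_le_max (z : ℂ) :
    ∃ σ ∈ ({1, -1, Complex.I, -Complex.I} : Finset ℂ), ‖z‖ / 2 ≤ (σ * z).re := by
  have h := Complex.norm_le_abs_re_add_abs_im z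
  by_contra! hc
  have h1 := hc 1 (by simp)
  have h2 := hc (-1) (by simp)
  have h3 := hc Complex.I (by simp)
  have h4 := hc (-Complex.I) (by simp)
  simp at h1 h2 h3 h4
  have h5 : |z.re| < ‖z‖ / 2 := abs_lt.2 ⟨by linarith, by linarith⟩
  have h6 : |z.im| < ‖z‖ / 2 := abs_lt.2 ⟨by linarith, by linarith⟩
  linarith

open Classical in
/-- If the exponential sum of `R` is at least `κ|R|` on a set of density `α`, then some list of
length less than `d` from `R`, with `d` slightly larger than `log (1 / α) / κ`, has at least a
proportion `κ / 8` of `R` among its signed sums. -/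
lemma exists_list_signedSum {R : Finset (ZMod N)} (hR : R.Nonempty) {κ α : ℝ} (hκ : 0 < κ)
    (hκ1 : κ ≤ 1) (hα : 0 < α) {d : ℕ} (hd : Real.log (4 / α) < d * κ / 5)
    (hlarge : α * N ≤ #(univ.filter fun y => κ * #R ≤ ‖expSum R y‖)) :
    ∃ l : List (ZMod N), l.length < d ∧ (∀ a ∈ l, a ∈ R) ∧
      κ / 8 * #R < #(R.filter fun x => IsSignedSum l x) := by
  by_contra! hc
  have hN : (0 : ℝ) < N := by exact_mod_cast NeZero.pos N
  have hR' : (0 : ℝ) < #R := by exact_mod_cast hR.card_pos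
  let T : Finset ℂ := {1, -1, Complex.I, -Complex.I}
  have hT : ∀ σ ∈ T, ‖σ‖ = 1 := by intro σ hσ; simp [T] at hσ; aesop
  have hTc : (#T : ℝ) ≤ 4 := by exact_mod_cast card_le_four
  have hnn : ∀ σ ∈ T, ∀ y, 0 ≤ 1 + (σ * expSum R y).re / #R := by
    intro σ hσ y
    have : 1 + (σ * expSum R y).re / #R = 1 + (σ * expSum R y / (#R : ℝ)).re := by
      rw [Complex.div_ofReal_re]
    rw [this]
    refine one_add_re_nonneg ?_
    rw [norm_div, norm_mul, hT σ hσ, one_mul, Complex.norm_real, Real.norm_eq_abs,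
      abs_of_pos hR', div_le_one hR']
    exact norm_expSum_le R y
  have hup : ∀ σ ∈ T, ∑ y, (1 + (σ * expSum R y).re / #R) ^ d ≤ (1 + κ / 8) ^ d * N := by
    intro σ hσ
    have := sum_rieszProduct_mul_pow_le (hT σ hσ) hR (by positivity) hc d [] (by simp) (by simp)
    simpa [rieszProduct] using this
  set Y := univ.filter fun y => κ * #R ≤ ‖expSum R y‖
  have hlow : #Y * (1 + κ / 2) ^ d ≤ ∑ σ ∈ T, ∑ y, (1 + (σ * expSum R y).re / #R) ^ d := by
    rw [sum_comm, ← nsmul_eq_mul, ← sum_const]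
    refine (sum_le_sum fun y hy => ?_).trans (sum_le_sum_of_subset_of_nonneg (subset_univ Y)
      fun y _ _ => sum_nonneg fun σ hσ => pow_nonneg (hnn σ hσ y) d)
    obtain ⟨σ, hσ, h1⟩ := norm_div_two_le_max (expSum R y)
    refine le_trans ?_ (single_le_sum (f := fun σ : ℂ => (1 + (σ * expSum R y).re / #R) ^ d)
      (fun σ hσ => pow_nonneg (hnn σ hσ y) d) hσ)
    have h2 := (mem_filter.1 hy).2
    refine pow_le_pow_left₀ (by positivity) (add_le_add_right ?_ 1) d
    rw [le_div_iff₀ hR']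
    linarith
  have h3 : ∑ σ ∈ T, ∑ y, (1 + (σ * expSum R y).re / #R) ^ d ≤ 4 * ((1 + κ / 8) ^ d * N) := by
    refine (sum_le_sum hup).trans ?_
    rw [sum_const, nsmul_eq_mul]
    gcongr
  have h4 : α * (1 + κ / 2) ^ d ≤ 4 * (1 + κ / 8) ^ d := by
    refine le_of_mul_le_mul_right ?_ hN
    have : α * N * (1 + κ / 2) ^ d ≤ #Y * (1 + κ / 2) ^ d := by gcongr
    linarith
  -- The surplus of `1 + κ/2` on `Y` over the moment bound `1 + κ/8` is at least `1 + κ/4 ≥ exp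
  -- (κ/5)` per factor, using `κ ≤ 1`.
  have h5 : (1 + κ / 8) ^ d * (1 + κ / 4) ^ d ≤ (1 + κ / 2) ^ d := by
    rw [← mul_pow]
    gcongr
    nlinarith
  have h6 : α * (1 + κ / 4) ^ d ≤ 4 := by
    refine le_of_mul_le_mul_right ?_ (show 0 < (1 + κ / 8) ^ d by positivity)
    nlinarith
  have h7 : Real.exp (κ / 5) ≤ 1 + κ / 4 := by
    have := Real.one_sub_inv_le_log_of_pos (show 0 < 1 + κ / 4 by positivity)
    rw [← Real.le_log_iff_exp_le (by positivity)]
    refine le_trans ?_ this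
    have e : 1 - (1 + κ / 4)⁻¹ = κ / 4 / (1 + κ / 4) := by field_simp; ring
    rw [e, le_div_iff₀ (by positivity)]
    nlinarith
  have h8 : 4 / α < (1 + κ / 4) ^ d := by
    calc 4 / α = Real.exp (Real.log (4 / α)) := (Real.exp_log (by positivity)).symm
      _ < Real.exp (d * (κ / 5)) := Real.exp_lt_exp.2 (by linarith)
      _ = Real.exp (κ / 5) ^ d := Real.exp_nat_mul _ _
      _ ≤ _ := by gcongr
  rw [div_lt_iff₀ hα] at h8
  linarith

end Riesz

/-! ### Size of Bohr sets -/

section Bohr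

lemma exists_real_rep (z : UnitAddCircle) : ∃ y : ℝ, (y : UnitAddCircle) = z ∧ |y| = ‖z‖ := by
  induction z using QuotientAddGroup.induction_on with
  | H x =>
    refine ⟨x - round x, ?_, (UnitAddCircle.norm_eq (x := x)).symm⟩
    rw [AddCircle.coe_sub, sub_eq_self]
    exact (AddCircle.coe_eq_zero_iff 1).2 ⟨round x, by simp⟩

variable {N : ℕ} [NeZero N]

lemma bohrSet_mono (Γ : Finset (ZMod N)) {γ γ' : ℝ} (h : γ ≤ γ') : bohrSet Γ γ ⊆ bohrSet Γ γ' := by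
  intro x hx
  simp only [bohrSet, mem_filter, mem_univ, true_and] at hx ⊢
  exact fun t ht => (hx t ht).trans h

lemma card_bohrSet_pos (Γ : Finset (ZMod N)) {γ : ℝ} (h : 0 ≤ γ) : 0 < #(bohrSet Γ γ) := by
  refine card_pos.2 ⟨0, ?_⟩
  simp [bohrSet, h]

lemma bohrSet_empty (γ : ℝ) : bohrSet (∅ : Finset (ZMod N)) γ = univ := by
  simp [bohrSet]

lemma isRegularBohr_empty (γ : ℝ) : IsRegularBohr (∅ : Finset (ZMod N)) γ := by
  intro η _
  simp [bohrSet_empty]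

/-- Doubling the radius of a Bohr set of rank `d` multiplies its size by at most `5 ^ d`. -/
lemma card_bohrSet_two_mul_le (Γ : Finset (ZMod N)) {γ : ℝ} (hγ : 0 < γ) :
    #(bohrSet Γ (2 * γ)) ≤ 5 ^ #Γ * #(bohrSet Γ γ) := by
  classical
  choose ρ hρ1 hρ2 using exists_real_rep
  let cell : ZMod N → (Γ → ℤ) := fun x t => ⌊ρ (ZMod.toAddCircle (t.1 * x)) / γ⌋
  -- The floor of a number in `[-2, 2]` takes five values, the endpoint 2 included. Points of one
  -- cell differ by an element of `bohrSet Γ γ`.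
  let T : Finset (Γ → ℤ) := Fintype.piFinset fun _ => Icc (-2) 2
  have hmaps : ∀ x ∈ bohrSet Γ (2 * γ), cell x ∈ T := by
    intro x hx
    simp only [bohrSet, mem_filter, mem_univ, true_and] at hx
    rw [Fintype.mem_piFinset]
    intro t
    have h := hx t.1 t.2
    rw [← hρ2, abs_le] at h
    rw [mem_Icc]
    constructor
    · rw [Int.le_floor, le_div_iff₀ hγ]; push_cast; linarith
    · rw [← Int.lt_add_one_iff, Int.floor_lt, div_lt_iff₀ hγ]; push_cast; linarith
  have hT : #T = 5 ^ #Γ := by simp [T, Fintype.piFinset]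
  rw [← hT, mul_comm (#T)]
  refine card_le_mul_card_image_of_maps_to hmaps _ fun c _ => ?_
  rcases (filter (fun x => cell x = c) (bohrSet Γ (2 * γ))).eq_empty_or_nonempty with h0 | ⟨z, hz⟩
  · rw [h0]; simp
  · rw [mem_filter] at hz
    refine card_le_card_of_injOn (fun x => x - z) ?_ (fun a _ b _ h => sub_left_injective h)
    intro x hx
    rw [mem_coe, mem_filter] at hx
    simp only [bohrSet, coe_filter, mem_univ, true_and, Set.mem_ofPred_eq]
    intro t ht
    have hc : cell x ⟨t, ht⟩ = cell z ⟨t, ht⟩ := by rw [hx.2, hz.2]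
    have := Int.abs_sub_lt_one_of_floor_eq_floor hc
    rw [← sub_div, abs_div, abs_of_pos hγ, div_lt_one hγ] at this
    rw [mul_sub, map_sub, ← hρ1 (ZMod.toAddCircle (t * x)), ← hρ1 (ZMod.toAddCircle (t * z)),
      ← AddCircle.coe_sub]
    refine le_trans ?_ this.le
    rw [UnitAddCircle.norm_eq]
    exact round_le _ 0 |>.trans (by simp)

end Bohr

/-! ### Regular radii -/

open MeasureTheory in
/-- A monotone function on an interval has a point with a two-sided slope bound, in the middle
third of the interval, relative to increments that stay in the interval. -/
lemma exists_forall_sub_le_of_monotone {h : ℝ → ℝ} (hh : Monotone h) {ℓ K : ℝ} (hℓ : 0 < ℓ)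
    (hK : 6 * (h (3 * ℓ) - h 0) < K * ℓ) :
    ∃ t ∈ Set.Icc ℓ (2 * ℓ), ∀ u ∈ Set.Icc 0 (3 * ℓ), |h u - h t| ≤ K * |u - t| := by
  -- Each bad `t` spans with `u t` an interval on which `h` grows by more than `K` times its length.
  -- Disjoint such intervals have total length at most `(h (3ℓ) - h 0) / K`, yet by Vitali their
  -- 6-fold dilates cover the middle third.
  by_contra! hcon
  choose! u hu hbad using hcon
  have hV : 0 ≤ h (3 * ℓ) - h 0 := sub_nonneg.2 (hh (by linarith))
  have hKpos : 0 < K := by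
    by_contra! hc
    nlinarith
  let c : ℝ → ℝ := fun t => (t + u t) / 2
  let r : ℝ → ℝ := fun t => |u t - t| / 2
  have hr : ∀ t ∈ Set.Icc ℓ (2 * ℓ), r t ≤ 3 * ℓ := by
    intro t ht
    have := hu t ht
    simp only [r]
    rw [div_le_iff₀ two_pos, abs_le]
    constructor <;> linarith [ht.1, ht.2, this.1, this.2]
  have hball : ∀ t, Metric.closedBall (c t) (r t) = Set.uIcc t (u t) := by
    intro t
    rw [Real.closedBall_eq_Icc]
    simp only [c, r]
    rcases le_total t (u t) with h1 | h1
    · rw [abs_of_nonneg (by linarith), Set.uIcc_of_le h1]; congr 1 <;> ring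
    · rw [abs_of_nonpos (by linarith), Set.uIcc_of_ge h1]; congr 1 <;> ring
  obtain ⟨v, hv, hdisj, hcov⟩ := Vitali.exists_disjoint_subfamily_covering_enlargement_closedBall
    (Set.Icc ℓ (2 * ℓ)) c r (3 * ℓ) hr 6 (by norm_num)
  have hrpos : ∀ t ∈ Set.Icc ℓ (2 * ℓ), 0 < r t := by
    intro t ht
    have h1 := hbad t ht
    have : u t ≠ t := by
      intro h2; rw [h2] at h1; simp at h1
    simp only [r]
    have := abs_pos.2 (sub_ne_zero.2 this)
    positivity
  have hvc : v.Countable := by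
    refine hdisj.countable_of_nonempty_interior fun t ht => ?_
    exact ⟨c t, Metric.ball_subset_interior_closedBall (Metric.mem_ball_self (hrpos t (hv ht)))⟩
  have hmass : ∀ F : Finset ℝ, (F : Set ℝ) ⊆ v → K * ∑ t ∈ F, 2 * r t ≤ h (3 * ℓ) - h 0 := by
    intro F hF
    -- the `h`-increments over disjoint intervals add up to at most the total increment
    let lo : ℝ → ℝ := fun t => min t (u t)
    let hi : ℝ → ℝ := fun t => max t (u t)
    have hlohi : ∀ t, lo t ≤ hi t := fun t => min_le_max
    have hdis : (F : Set ℝ).PairwiseDisjoint fun t => Set.Ioc (h (lo t)) (h (hi t)) := by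
      intro s hs t ht hst
      have hd := hdisj (hF hs) (hF ht) hst
      simp only [Function.onFun, hball] at hd
      have key : hi s < lo t ∨ hi t < lo s := by
        by_contra! hc
        have : max (lo s) (lo t) ∈ Set.uIcc s (u s) ∩ Set.uIcc t (u t) :=
          ⟨⟨le_max_left _ _, max_le (hlohi s) hc.1⟩, ⟨le_max_right _ _, max_le hc.2 (hlohi t)⟩⟩
        exact (Set.disjoint_iff.1 hd) this
      simp only [Function.onFun]
      rw [Set.disjoint_left]
      rintro x ⟨h1, h2⟩ ⟨h3, h4⟩
      rcases key with hk | hk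
      · linarith [hh hk.le]
      · linarith [hh hk.le]
    have hvol : volume (⋃ t ∈ F, Set.Ioc (h (lo t)) (h (hi t))) ≤
        volume (Set.Ioc (h 0) (h (3 * ℓ))) := by
      refine measure_mono (Set.iUnion₂_subset fun t ht => Set.Ioc_subset_Ioc (hh ?_) (hh ?_))
      · have := hu t (hv (hF ht)); have := (hv (hF ht)).1
        exact le_min (by linarith) (hu t (hv (hF ht))).1
      · have := (hv (hF ht)).2
        exact max_le (by linarith) (hu t (hv (hF ht))).2
    rw [measure_biUnion_finset hdis (fun _ _ => measurableSet_Ioc)] at hvol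
    simp only [Real.volume_Ioc] at hvol
    rw [← ENNReal.ofReal_sum_of_nonneg (fun t _ => sub_nonneg.2 (hh (hlohi t))),
      ENNReal.ofReal_le_ofReal_iff hV] at hvol
    refine le_trans ?_ hvol
    rw [mul_sum]
    refine sum_le_sum fun t ht => ?_
    have h1 := (hbad t (hv (hF ht))).le
    have : |h (u t) - h t| = h (hi t) - h (lo t) := by
      simp only [hi, lo]
      rcases le_total t (u t) with h2 | h2
      · rw [max_eq_right h2, min_eq_left h2, abs_of_nonneg (sub_nonneg.2 (hh h2))]
      · rw [max_eq_left h2, min_eq_right h2, abs_of_nonpos (sub_nonpos.2 (hh h2))]; ring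
    simp only [r]
    linarith
  have hsum : ∑' t : v, ENNReal.ofReal (2 * r t) ≤ ENNReal.ofReal ((h (3 * ℓ) - h 0) / K) := by
    rw [ENNReal.tsum_eq_iSup_sum]
    refine iSup_le fun F => ?_
    have hF := hmass (F.map (Function.Embedding.subtype _)) (by
      intro x hx
      simp only [coe_map, Function.Embedding.subtype_apply, Set.mem_image] at hx
      obtain ⟨y, -, rfl⟩ := hx
      exact y.2)
    rw [sum_map] at hF
    rw [← ENNReal.ofReal_sum_of_nonneg
      (fun (t : v) _ => mul_nonneg two_pos.le (hrpos t.1 (hv t.2)).le)]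
    refine ENNReal.ofReal_le_ofReal ?_
    rw [le_div_iff₀ hKpos, mul_comm]
    exact hF
  have hcover : volume (Set.Icc ℓ (2 * ℓ)) ≤ ∑' t : v, 6 * ENNReal.ofReal (2 * r t) := by
    have : Set.Icc ℓ (2 * ℓ) ⊆ ⋃ t ∈ v, Metric.closedBall (c t) (6 * r t) := by
      intro t ht
      obtain ⟨b, hb, hsub⟩ := hcov t ht
      refine Set.mem_biUnion hb (hsub ?_)
      rw [hball]; exact Set.left_mem_uIcc
    refine (measure_mono this).trans ((measure_biUnion_le volume hvc _).trans ?_)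
    refine ENNReal.tsum_le_tsum fun t => ?_
    rw [Real.volume_closedBall, show 2 * (6 * r t) = 6 * (2 * r t) by ring,
      ENNReal.ofReal_mul (by norm_num)]
    simp
  rw [ENNReal.tsum_mul_left, Real.volume_Icc] at hcover
  have h6 := hcover.trans (mul_le_mul_right hsum 6)
  rw [show (6 : ENNReal) = ENNReal.ofReal 6 by simp, ← ENNReal.ofReal_mul (by norm_num),
    ENNReal.ofReal_le_ofReal_iff (by positivity), ← mul_div_assoc, le_div_iff₀ hKpos] at h6
  linarith

/-- Every range `[γ₀, 2γ₀]` of radii contains one at which the Bohr set is regular. -/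
lemma exists_isRegularBohr {N : ℕ} [NeZero N] (Γ : Finset (ZMod N)) {γ₀ : ℝ} (hγ₀ : 0 < γ₀) :
    ∃ γ, γ₀ ≤ γ ∧ γ ≤ 2 * γ₀ ∧ IsRegularBohr Γ γ := by
  rcases Γ.eq_empty_or_nonempty with rfl | hΓ
  · exact ⟨γ₀, le_rfl, by linarith, isRegularBohr_empty γ₀⟩
  have hd : (1 : ℝ) ≤ #Γ := by exact_mod_cast hΓ.card_pos
  set d : ℝ := (#Γ : ℝ)
  have hpos : ∀ γ : ℝ, 0 < γ → (0 : ℝ) < #(bohrSet Γ γ) := fun γ h => by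
    exact_mod_cast card_bohrSet_pos Γ h.le
  have hdbl : ∀ γ : ℝ, 0 < γ →
      Real.log #(bohrSet Γ (2 * γ)) ≤ d * Real.log 5 + Real.log #(bohrSet Γ γ) := by
    intro γ hγ
    have h1 : (#(bohrSet Γ (2 * γ)) : ℝ) ≤ 5 ^ #Γ * #(bohrSet Γ γ) := by
      exact_mod_cast card_bohrSet_two_mul_le Γ hγ
    have h2 := Real.log_le_log (hpos _ (by positivity)) h1
    rwa [Real.log_mul (by positivity) (hpos γ hγ).ne', Real.log_pow] at h2
  set γ₁ : ℝ := γ₀ / 2 with hγ₁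
  have hγ₁pos : 0 < γ₁ := by positivity
  -- In logarithmic scale, multiplying the radius by `1 + η` is a translation, and the middle third
  -- of `[0, 3 log 2]` corresponds to radii in `[γ₀, 2γ₀]`.
  let h : ℝ → ℝ := fun t => Real.log #(bohrSet Γ (Real.exp t * γ₁))
  have hmono : Monotone h := by
    intro s t hst
    refine Real.log_le_log (hpos _ (by positivity)) ?_
    exact_mod_cast card_le_card (bohrSet_mono Γ (by gcongr))
  have hl2 : 0 < Real.log 2 := Real.log_pos (by norm_num)
  have he2 : Real.exp (Real.log 2) = 2 := Real.exp_log two_pos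
  have hincr : h (3 * Real.log 2) - h 0 ≤ 3 * (d * Real.log 5) := by
    have e3 : Real.exp (3 * Real.log 2) * γ₁ = 2 * (2 * (2 * γ₁)) := by
      rw [show 3 * Real.log 2 = Real.log 2 + Real.log 2 + Real.log 2 by ring, Real.exp_add,
        Real.exp_add, he2]
      ring
    simp only [h, e3, Real.exp_zero, one_mul]
    have := hdbl γ₁ hγ₁pos
    have := hdbl (2 * γ₁) (by positivity)
    have := hdbl (2 * (2 * γ₁)) (by positivity)
    linarith
  -- From `25 < 32`. Three doublings make the slope condition `18 d log 5 < K log 2`, so `K = 45 d`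
  -- is admissible.
  have hl5 : 2 * Real.log 5 < 5 * Real.log 2 := by
    have : Real.log ((5 : ℝ) ^ 2) < Real.log ((2 : ℝ) ^ 5) :=
      Real.log_lt_log (by norm_num) (by norm_num)
    rw [Real.log_pow, Real.log_pow] at this
    exact_mod_cast this
  obtain ⟨t, ht, hslope⟩ := exists_forall_sub_le_of_monotone hmono hl2 (K := 45 * d) (by nlinarith)
  have hexp1 : 2 ≤ Real.exp t := by rw [← he2]; exact Real.exp_le_exp.2 ht.1
  have hexp2 : Real.exp t ≤ 4 := by
    rw [show (4 : ℝ) = Real.exp (2 * Real.log 2) by rw [two_mul, Real.exp_add, he2]; norm_num]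
    exact Real.exp_le_exp.2 ht.2
  refine ⟨Real.exp t * γ₁, by nlinarith, by nlinarith, ?_⟩
  intro η hη
  have hη1 : |η| ≤ 1 / 100 := by
    have : 100 * 1 * |η| ≤ 100 * d * |η| := by gcongr
    linarith
  have hη2 := abs_le.1 hη1
  have h1η : 0 < 1 + η := by linarith
  have hu : Real.exp (t + Real.log (1 + η)) * γ₁ = (1 + η) * (Real.exp t * γ₁) := by
    rw [Real.exp_add, Real.exp_log h1η]; ring
  have hlog_up : Real.log (1 + η) ≤ η := by linarith [Real.log_le_sub_one_of_pos h1η]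
  have hlog_lo : η / (1 + η) ≤ Real.log (1 + η) := by
    have := Real.one_sub_inv_le_log_of_pos h1η
    have e : 1 - (1 + η)⁻¹ = η / (1 + η) := by field_simp; ring
    linarith
  have hl2' : 1 / 2 < Real.log 2 := by linarith [Real.log_two_gt_d9]
  have hη3 : -(1 / 50) ≤ η / (1 + η) := by rw [le_div_iff₀ h1η]; linarith
  have hmem : t + Real.log (1 + η) ∈ Set.Icc 0 (3 * Real.log 2) := by
    constructor <;> linarith [ht.1, ht.2]
  have hs := hslope _ hmem
  rw [add_sub_cancel_left] at hs
  have hB := hpos (Real.exp t * γ₁) (by positivity)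
  have hB' := hpos ((1 + η) * (Real.exp t * γ₁)) (by positivity)
  have hh1 : Real.exp (h t) = #(bohrSet Γ (Real.exp t * γ₁)) := Real.exp_log hB
  have hh2 : Real.exp (h (t + Real.log (1 + η))) = #(bohrSet Γ ((1 + η) * (Real.exp t * γ₁))) := by
    simp only [h]; rw [hu, Real.exp_log hB']
  have hs' := abs_le.1 hs
  have hx0 : 0 ≤ 100 * d * |η| := by positivity
  rcases le_total 0 η with h0 | h0
  · have hle : (#(bohrSet Γ (Real.exp t * γ₁)) : ℝ) ≤ #(bohrSet Γ ((1 + η) * (Real.exp t * γ₁))) := by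
      exact_mod_cast card_le_card (bohrSet_mono Γ (by
        have : 0 ≤ η * (Real.exp t * γ₁) := by positivity
        linarith))
    rw [abs_of_nonneg h0] at hη hx0 ⊢
    refine ⟨(mul_le_of_le_one_left hB.le (by linarith)).trans hle, ?_⟩
    rw [← hh1, ← hh2]
    have hlog0 : 0 ≤ Real.log (1 + η) := Real.log_nonneg (by linarith)
    have h3 : h (t + Real.log (1 + η)) ≤ 0.45 * (100 * d * η) + h t := by
      rw [abs_of_nonneg hlog0] at hs'
      have h4 : 45 * d * Real.log (1 + η) ≤ 45 * d * η := by gcongr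
      linarith [hs'.2]
    refine (Real.exp_le_exp.2 h3).trans ?_
    rw [Real.exp_add]
    refine mul_le_mul_of_nonneg_right ?_ (Real.exp_pos _).le
    -- With `x = 100dη ≤ 1`, `exp (0.45x) ≤ 1 + 0.45x + (0.45x)² ≤ 1 + x`.
    have h4 := Real.abs_exp_sub_one_sub_id_le (x := 0.45 * (100 * d * η))
      (by rw [abs_of_nonneg (by positivity)]; linarith)
    have := (abs_le.1 h4).2
    nlinarith
  · have hle : (#(bohrSet Γ ((1 + η) * (Real.exp t * γ₁))) : ℝ) ≤ #(bohrSet Γ (Real.exp t * γ₁)) := by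
      exact_mod_cast card_le_card (bohrSet_mono Γ (by
        have : 0 ≤ -η * (Real.exp t * γ₁) := mul_nonneg (by linarith) (by positivity)
        linarith))
    rw [abs_of_nonpos h0] at hη hx0 ⊢
    refine ⟨?_, hle.trans (le_mul_of_one_le_left hB.le (by linarith))⟩
    rw [← hh1, ← hh2]
    have hlog0 : Real.log (1 + η) ≤ 0 := by linarith
    -- A crude factor 2 suffices, since `45 · 2 = 90 ≤ 100`.
    have hη4 : 2 * η ≤ η / (1 + η) := by
      rw [le_div_iff₀ h1η]
      linarith [mul_nonneg (neg_nonneg.2 h0) (show 0 ≤ 1 + 2 * η by linarith)]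
    have h3 : -(100 * d * -η) + h t ≤ h (t + Real.log (1 + η)) := by
      rw [abs_of_nonpos hlog0] at hs'
      have h4 : 45 * d * -Real.log (1 + η) ≤ 45 * d * (-(2 * η)) := by gcongr; linarith
      linarith [hs'.1]
    refine le_trans ?_ (Real.exp_le_exp.2 h3)
    rw [Real.exp_add]
    refine mul_le_mul_of_nonneg_right ?_ (Real.exp_pos _).le
    linarith [Real.add_one_le_exp (-(100 * d * -η))]

/-! ### From spectral structure to a dense translate -/

section Increment

variable {N : ℕ} [NeZero N]

/-- The threshold `1/6` comes from `cos (π/3) = 1/2`. -/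
lemma half_le_re_stdAddChar {x : ZMod N} (h : ‖ZMod.toAddCircle x‖ ≤ 1 / 6) :
    1 / 2 ≤ (ZMod.stdAddChar x : ℂ).re := by
  obtain ⟨y, hy, hy'⟩ := exists_real_rep (ZMod.toAddCircle x)
  have h1 : (ZMod.stdAddChar x : ℂ) = Circle.exp (2 * Real.pi * y) := by
    rw [ZMod.stdAddChar_apply, ZMod.toCircle, AddChar.compAddMonoidHom_apply,
      AddCircle.toCircle_addChar, AddChar.coe_mk, ← hy, AddCircle.toCircle_apply_mk, div_one]
  rw [← hy'] at h
  rw [h1, Circle.coe_exp, Complex.exp_ofReal_mul_I_re, ← Real.cos_abs, ← Real.cos_pi_div_three]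
  refine Real.cos_le_cos_of_nonneg_of_le_pi (abs_nonneg _) (by linarith [Real.pi_pos]) ?_
  rw [abs_mul, abs_of_pos (by positivity)]
  nlinarith [Real.pi_pos]

lemma half_card_le_norm_expSum {B : Finset (ZMod N)} {r : ZMod N}
    (h : ∀ y ∈ B, ‖ZMod.toAddCircle (r * y)‖ ≤ 1 / 6) : (#B : ℝ) / 2 ≤ ‖expSum B r‖ := by
  refine le_trans ?_ (Complex.re_le_norm _)
  rw [expSum, Complex.re_sum]
  calc (#B : ℝ) / 2 = ∑ _y ∈ B, (1 / 2 : ℝ) := by simp; ring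
    _ ≤ _ := sum_le_sum fun y hy => half_le_re_stdAddChar (by rw [mul_comm]; exact h y hy)

lemma card_image_add_inter {N : ℕ} (A B : Finset (ZMod N)) (t : ZMod N) :
    #((A.image fun a => a + t) ∩ B) = #((A ×ˢ B).filter fun p => p.2 - p.1 = t) := by
  symm
  refine card_bij (fun p _ => p.2) ?_ ?_ ?_
  · rintro ⟨a, b⟩ h
    simp only [mem_filter, mem_product, mem_inter, mem_image] at h ⊢
    exact ⟨⟨a, h.1.1, by rw [← h.2]; abel⟩, h.1.2⟩
  · rintro ⟨a, b⟩ h ⟨a', b'⟩ h' hb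
    simp only [mem_filter] at h h' hb
    subst hb
    have : b - a = b - a' := h.2.trans h'.2.symm
    rw [sub_right_injective this]
  · intro b hb
    simp only [mem_inter, mem_image] at hb
    obtain ⟨⟨a, ha, rfl⟩, hb⟩ := hb
    exact ⟨(a, a + t), by simp [ha, hb], rfl⟩

/-- If the exponential sum of `B` is large at many points of the large spectrum of `A`, then a
translate of `A` is dense in `B`. -/
lemma exists_dense_translate {A B U : Finset (ZMod N)} {θ : ℝ} (hθ : 0 ≤ θ) (hA : A.Nonempty)
    (hB : B.Nonempty) (hU : U ⊆ largeSpectrum A θ)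
    (hBU : ∀ r ∈ U, (#B : ℝ) / 2 ≤ ‖expSum B r‖) :
    ∃ t : ZMod N, #U * θ ^ 2 * #A * #B ≤ 4 * N * (#((A.image fun a => a + t) ∩ B) : ℝ) := by
  have hA' : (0 : ℝ) < #A := by exact_mod_cast hA.card_pos
  have hB' : (0 : ℝ) < #B := by exact_mod_cast hB.card_pos
  let h : ZMod N → ℕ := fun t => #((A ×ˢ B).filter fun p => p.2 - p.1 = t)
  obtain ⟨t, -, ht⟩ := exists_max_image univ h univ_nonempty
  refine ⟨t, ?_⟩
  rw [card_image_add_inter]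
  change _ ≤ 4 * N * (h t : ℝ)
  have h1 : ∑ t, (h t : ℝ) = #A * #B := by
    have : ∑ t, h t = #A * #B := by
      rw [← card_product]
      exact (card_eq_sum_card_fiberwise (f := fun p : ZMod N × ZMod N => p.2 - p.1) (t := univ)
        (by simp)).symm
    exact_mod_cast this
  -- `L²` is bounded by the maximum times `L¹`; Parseval gives the opposite bound, through the
  -- frequencies in `U`.
  have h2 : ∑ x, (h x : ℝ) ^ 2 ≤ h t * (#A * #B) := by
    rw [← h1, mul_sum]
    refine sum_le_sum fun x _ => ?_
    rw [sq]
    have : (h x : ℝ) ≤ h t := by exact_mod_cast ht x (mem_univ x)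
    gcongr
  have h3 : ∀ r : ZMod N, ∑ x, (h x : ℂ) * ZMod.stdAddChar (x * r) =
      expSum B r * (starRingEnd ℂ) (expSum A r) := by
    intro r
    rw [sum_mul_stdAddChar_fiber, sum_product_right, expSum, expSum, map_sum, sum_mul_sum]
    refine sum_congr rfl fun b _ => sum_congr rfl fun a _ => ?_
    rw [conj_stdAddChar, sub_mul, sub_eq_add_neg, AddChar.map_add_eq_mul]
  have h4 := parseval_zmod fun x => (h x : ℂ)
  simp only [h3, norm_mul, RCLike.norm_conj, Complex.norm_natCast] at h4
  have h5 : #U * ((#B : ℝ) / 2 * (θ * #A)) ^ 2 ≤ ∑ r, (‖expSum B r‖ * ‖expSum A r‖) ^ 2 := by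
    rw [← nsmul_eq_mul, ← sum_const]
    refine (sum_le_sum fun r hr => ?_).trans
      (sum_le_sum_of_subset_of_nonneg (subset_univ U) fun _ _ _ => sq_nonneg _)
    have := hBU r hr
    have := mem_largeSpectrum.1 (hU hr)
    gcongr
  rw [h4] at h5
  have h6 := h5.trans (mul_le_mul_of_nonneg_left h2 (Nat.cast_nonneg N))
  refine le_of_mul_le_mul_right ?_ (mul_pos hA' hB')
  linarith

lemma norm_toAddCircle_mul_le_of_isSignedSum {l : List (ZMod N)} {r y : ZMod N} {γ : ℝ}
    (hr : IsSignedSum l r) (hl : ∀ a ∈ l, ‖ZMod.toAddCircle (a * y)‖ ≤ γ) :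
    ‖ZMod.toAddCircle (r * y)‖ ≤ l.length * γ := by
  induction l generalizing r with
  | nil => simp only [IsSignedSum] at hr; simp [hr]
  | cons a l ih =>
    have ha := hl a (by simp)
    have hl' : ∀ b ∈ l, ‖ZMod.toAddCircle (b * y)‖ ≤ γ := fun b hb => hl b (by simp [hb])
    have hγ : 0 ≤ γ := (norm_nonneg _).trans ha
    simp only [List.length_cons, Nat.cast_add, Nat.cast_one]
    rcases hr with h | h | h
    · linarith [ih h hl']
    · have h1 := ih h hl'
      have : r * y = (r + a) * y - a * y := by ring
      rw [this, map_sub]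
      exact (norm_sub_le _ _).trans (by linarith)
    · have h1 := ih h hl'
      have : r * y = (r - a) * y + a * y := by ring
      rw [this, map_add]
      exact (norm_add_le _ _).trans (by linarith)

/-- A set of large eighth energy has a large subset consisting of short signed sums of elements of
a small set. -/
lemma exists_small_spanning_set {Δ : Finset (ZMod N)} {κ α s : ℝ} {d : ℕ} (hκ : 0 < κ)
    (hκ1 : κ ≤ 1) (hα : 0 < α) (hs : 0 < s) (hd : Real.log (4 / α) < d * κ / 5)
    (hsΔ : 2 * s ≤ #Δ)
    (hEs : 2 ^ 8 * s ^ 7 ≤ higherEnergy 4 Δ)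
    (hEκ : 2 ^ 9 * κ ^ 6 * (#Δ : ℝ) ^ 7 ≤ higherEnergy 4 Δ)
    (hEα : 2 ^ 9 * α * (#Δ : ℝ) ^ 8 ≤ higherEnergy 4 Δ) (n : ℕ) :
    ∃ Γ U : Finset (ZMod N), U ⊆ Δ ∧ #Γ ≤ n * d ∧
      (∀ r ∈ U, ∃ l : List (ZMod N), l.length ≤ d ∧ (∀ a ∈ l, a ∈ Γ) ∧ IsSignedSum l r) ∧
      (s ≤ #U ∨ n * (κ * #Δ / 16) ≤ #U) := by
  classical
  induction n with
  | zero => exact ⟨∅, ∅, by simp⟩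
  | succ n ih =>
    obtain ⟨Γ, U, hUΔ, hΓ, hspan, hor⟩ := ih
    by_cases hUs : s ≤ #U
    · exact ⟨Γ, U, hUΔ, hΓ.trans (by gcongr; omega), hspan, Or.inl hUs⟩
    have hUn := hor.resolve_left hUs
    push Not at hUs
    set R := Δ \ U
    have hRΔ : (#R : ℝ) ≤ #Δ := by exact_mod_cast card_le_card sdiff_subset
    have hRc : (#R : ℝ) + #U = #Δ := by exact_mod_cast card_sdiff_add_card_eq_card hUΔ
    have hRhalf : (#Δ : ℝ) / 2 ≤ #R := by linarith
    have hRpos : (0 : ℝ) < #R := by linarith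
    have hRne : R.Nonempty := card_pos.1 (by exact_mod_cast hRpos)
    -- As `|U| < s`, the captured part accounts for at most half of the energy bound, so `R` keeps a
    -- `2 ^ (-8)` share of it.
    have hEU : (higherEnergy 4 U : ℝ) ≤ s ^ 7 :=
      (higherEnergy_four_le_card_pow U).trans (by gcongr)
    have hER := higherEnergy_four_le_sdiff hUΔ
    have hER' : (higherEnergy 4 Δ : ℝ) ≤ 2 ^ 8 * higherEnergy 4 R := by linarith
    have h1 : 2 * κ ^ 6 * (#R : ℝ) ^ 7 ≤ higherEnergy 4 R := by
      have : 2 * κ ^ 6 * (#R : ℝ) ^ 7 ≤ 2 * κ ^ 6 * (#Δ : ℝ) ^ 7 := by gcongr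
      linarith
    have h2 : 2 * α * (#R : ℝ) ^ 8 ≤ higherEnergy 4 R := by
      have : 2 * α * (#R : ℝ) ^ 8 ≤ 2 * α * (#Δ : ℝ) ^ 8 := by gcongr
      linarith
    obtain ⟨l, hl, hlR, hcard⟩ := exists_list_signedSum hRne hκ hκ1 hα hd
      (card_large_expSum hRne h1 h2)
    set V := R.filter fun x => IsSignedSum l x
    have hdisj : Disjoint U V :=
      (disjoint_sdiff (s := U) (t := Δ)).mono_right (filter_subset _ _)
    refine ⟨Γ ∪ l.toFinset, U ∪ V,
      union_subset hUΔ ((filter_subset _ _).trans sdiff_subset), ?_, ?_, Or.inr ?_⟩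
    · have := card_union_le Γ l.toFinset
      have := l.toFinset_card_le
      rw [add_mul, one_mul]
      omega
    · intro r hr
      rcases mem_union.1 hr with h | h
      · obtain ⟨l', h1, h2, h3⟩ := hspan r h
        exact ⟨l', h1, fun a ha => mem_union_left _ (h2 a ha), h3⟩
      · exact ⟨l, hl.le, fun a ha => mem_union_right _ (List.mem_toFinset.2 ha), (mem_filter.1 h).2⟩
    · rw [card_union_of_disjoint hdisj]
      push_cast
      have : κ / 8 * (#Δ / 2) ≤ κ / 8 * #R := by gcongr
      linarith

end Increment

/-! ### Choice of parameters -/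

set_option maxHeartbeats 1000000 in
/-- The density increment on a regular Bohr set of small rank, for `δ` below an absolute
constant. -/
lemma exists_regular_bohrSet_of_small_density {μ : ℝ} (hμ : 0 < μ) (hμ1 : μ ≤ 1 / 100) {N : ℕ}
    [NeZero N] {A : Finset (ZMod N)} {δ θ : ℝ} (hA : A.Nonempty) (hAδ : (#A : ℝ) = δ * N)
    (hδ : 0 < δ) (hL : 20 < Real.log (1 / δ)) (hlog : δ ^ (μ / 20) * Real.log (1 / δ) < 1)
    (hθ1 : δ ^ (1 + μ) ≤ θ)
    (hD : δ ^ (2 * μ) * θ ^ (-2 : ℝ) * δ ^ (-1 : ℝ) ≤ (#(largeSpectrum A θ) : ℝ))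
    (hE : δ ^ (-20 * μ) * θ ^ 8 * δ * (#(largeSpectrum A θ) : ℝ) ^ 8
      ≤ (higherEnergy 4 (largeSpectrum A θ) : ℝ)) :
    ∃ (Γ : Finset (ZMod N)) (γ : ℝ), 0 < γ ∧ γ ≤ 1 / 2 ∧ IsRegularBohr Γ γ ∧
      (#Γ : ℝ) ≤ 7500 * δ ^ (-1 + μ / 2) ∧ 1 / 2000 * δ ^ (1 - μ / 2) ≤ γ ∧
      ∃ t : ZMod N, 1 / 2000 * δ ^ (1 - μ / 2) * (#(bohrSet Γ γ) : ℝ)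
        ≤ (#((A.image fun a => a + t) ∩ bohrSet Γ γ) : ℝ) := by
  have hN : (0 : ℝ) < N := by exact_mod_cast NeZero.pos N
  set L := Real.log (1 / δ) with hLdef
  have hLδ : Real.log δ = -L := by rw [hLdef, one_div, Real.log_inv, neg_neg]
  have hδ1 : δ < 1 := by
    rw [← Real.log_neg_iff hδ]; linarith
  have hadd : ∀ a b : ℝ, δ ^ a * δ ^ b = δ ^ (a + b) := fun a b => (Real.rpow_add hδ a b).symm
  have hmono : ∀ {a b : ℝ}, b ≤ a → δ ^ a ≤ δ ^ b := fun h =>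
    Real.rpow_le_rpow_of_exponent_ge hδ hδ1.le h
  have hpos : ∀ a : ℝ, 0 < δ ^ a := fun a => Real.rpow_pos_of_pos hδ a
  have hpow : ∀ (a : ℝ) (k : ℕ), (δ ^ a) ^ k = δ ^ (a * k) := fun a k =>
    (Real.rpow_mul_natCast hδ.le a k).symm
  have hδself : δ ^ (1 : ℝ) = δ := Real.rpow_one δ
  -- `L > 20` lets a power of `δ` absorb the numerical constants below.
  have hbig : (2 : ℝ) ^ 8 ≤ δ ^ (-(1 / 2) : ℝ) := by
    rw [Real.rpow_def_of_pos hδ, hLδ]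
    have h1 : (10 : ℝ) ≤ -L * -(1 / 2) := by linarith
    refine le_trans ?_ (Real.exp_le_exp.2 h1)
    have h2 : (2 : ℝ) ≤ Real.exp 1 := by linarith [Real.add_one_le_exp (1 : ℝ)]
    calc (2 : ℝ) ^ 8 ≤ 2 ^ 10 := by norm_num
      _ ≤ Real.exp 1 ^ 10 := by gcongr
      _ = Real.exp 10 := by rw [← Real.exp_nat_mul]; norm_num
  have hLq : L ≤ δ ^ (-(μ / 20)) := by
    rw [Real.rpow_neg hδ.le, ← one_div, le_div_iff₀ (hpos _)]
    linarith
  have hθ : 0 < θ := (hpos _).trans_le hθ1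
  set Δ := largeSpectrum A θ
  set D : ℝ := (#Δ : ℝ)
  have hDθ : δ ^ (2 * μ - 1) ≤ D * θ ^ 2 := by
    have h1 : θ ^ (-2 : ℝ) = (θ ^ 2)⁻¹ := by
      rw [Real.rpow_neg hθ.le]; norm_num
    rw [h1] at hD
    have h2 : δ ^ (2 * μ - 1) = δ ^ (2 * μ) * (θ ^ 2)⁻¹ * δ ^ (-1 : ℝ) * θ ^ 2 := by
      rw [sub_eq_add_neg, ← hadd]; field_simp
    rw [h2]
    gcongr
  have hDpos : 0 < D := by
    by_contra! hc
    have := hpos (2 * μ - 1)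
    nlinarith [sq_nonneg θ]
  -- Chosen so that `sθ²` is exactly the gain `δ ^ (-μ/2)` over the trivial density `δ`.
  set s : ℝ := δ ^ (-(μ / 2)) / θ ^ 2 with hs
  have hspos : 0 < s := div_pos (hpos _) (by positivity)
  have hsθ : s * θ ^ 2 = δ ^ (-(μ / 2)) := by rw [hs]; field_simp
  -- In `hEκ` the exponents balance exactly at `6 - 12μ`; the 3 absorbs `2 ^ 9 ≤ 3 ^ 6`.
  set κ : ℝ := δ ^ (1 - 2 * μ) / 3 with hκdef
  have hκ : 0 < κ := div_pos (hpos _) (by norm_num)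
  have hκ1 : κ ≤ 1 := by
    have : δ ^ (1 - 2 * μ) ≤ 1 := Real.rpow_le_one hδ.le hδ1.le (by linarith)
    rw [hκdef]; linarith
  have hθk : ∀ k : ℕ, δ ^ ((1 + μ) * k) ≤ θ ^ k := by
    intro k; rw [← hpow]; gcongr
  have hE' : δ ^ (1 - 20 * μ) * θ ^ 8 * D ^ 8 ≤ higherEnergy 4 Δ := by
    have : δ ^ (1 - 20 * μ) = δ ^ (-20 * μ) * δ := by
      nth_rewrite 3 [← hδself]; rw [hadd]; ring_nf
    rw [this]; linarith
  have hsΔ : 2 * s ≤ D := by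
    refine le_of_mul_le_mul_right ?_ (show 0 < θ ^ 2 by positivity)
    refine le_trans ?_ hDθ
    have h1 : δ ^ (2 * μ - 1) = δ ^ (-(μ / 2)) * δ ^ (5 * μ / 2 - 1) := by rw [hadd]; ring_nf
    have h2 : (2 : ℝ) ≤ δ ^ (5 * μ / 2 - 1) :=
      le_trans (by norm_num) (hbig.trans (hmono (by linarith)))
    rw [mul_assoc, hsθ, h1, mul_comm]
    exact mul_le_mul_of_nonneg_left h2 (hpos _).le
  have hEs : 2 ^ 8 * s ^ 7 ≤ higherEnergy 4 Δ := by
    refine le_trans ?_ hE'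
    refine le_of_mul_le_mul_right ?_ (show 0 < (θ ^ 2) ^ 7 by positivity)
    calc 2 ^ 8 * s ^ 7 * (θ ^ 2) ^ 7 = 2 ^ 8 * (s * θ ^ 2) ^ 7 := by ring
      _ = 2 ^ 8 * δ ^ (-(μ / 2) * (7 : ℕ)) := by rw [hsθ, hpow]
      _ ≤ δ ^ (-(1 / 2) : ℝ) * δ ^ (-(μ / 2) * (7 : ℕ)) := by gcongr
      _ ≤ δ ^ (1 - 20 * μ) * δ ^ ((1 + μ) * (6 : ℕ)) * δ ^ ((2 * μ - 1) * (8 : ℕ)) := by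
          rw [hadd, hadd, hadd]; refine hmono ?_; push_cast; linarith
      _ ≤ δ ^ (1 - 20 * μ) * θ ^ 6 * (D * θ ^ 2) ^ 8 := by
          rw [← hpow (2 * μ - 1)]
          gcongr
          exact hθk 6
      _ = _ := by ring
  have hEκ : 2 ^ 9 * κ ^ 6 * D ^ 7 ≤ higherEnergy 4 Δ := by
    refine le_trans ?_ hE'
    calc 2 ^ 9 * κ ^ 6 * D ^ 7 ≤ (3 * κ) ^ 6 * D ^ 7 := by
          have : 0 ≤ κ ^ 6 * D ^ 7 := by positivity
          rw [mul_pow]; linarith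
      _ = δ ^ ((1 - 2 * μ) * (6 : ℕ)) * D ^ 7 := by
          rw [hκdef, mul_div_cancel₀ _ (by norm_num), hpow]
      _ ≤ δ ^ (1 - 20 * μ) * δ ^ ((1 + μ) * (6 : ℕ)) * δ ^ (2 * μ - 1) * D ^ 7 := by
          rw [hadd, hadd]; gcongr ?_ * _; refine hmono ?_; push_cast; linarith
      _ ≤ δ ^ (1 - 20 * μ) * θ ^ 6 * (D * θ ^ 2) * D ^ 7 := by
          gcongr
          exact hθk 6
      _ = _ := by ring
  set α : ℝ := δ ^ (9 : ℝ) / 2 ^ 9 with hα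
  have hαpos : 0 < α := div_pos (hpos _) (by norm_num)
  have hEα : 2 ^ 9 * α * D ^ 8 ≤ higherEnergy 4 Δ := by
    refine le_trans ?_ hE'
    rw [hα, mul_div_cancel₀ _ (by norm_num)]
    gcongr ?_ * _
    calc δ ^ (9 : ℝ) ≤ δ ^ (1 - 20 * μ) * δ ^ ((1 + μ) * (8 : ℕ)) := by
          rw [hadd]; refine hmono ?_; push_cast; linarith
      _ ≤ _ := by gcongr; exact hθk 8
  -- `log (4/α) = 11 log 2 + 9L < 10L`, and `dκ/5` must exceed it.
  obtain ⟨d, hd1, hd2⟩ : ∃ d : ℕ, 50 * L / κ < d ∧ (d : ℝ) ≤ 51 * L / κ := by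
    refine ⟨⌊50 * L / κ⌋₊ + 1, by exact_mod_cast Nat.lt_floor_add_one _, ?_⟩
    have h1 := Nat.floor_le (show 0 ≤ 50 * L / κ by positivity)
    have h2 : 1 ≤ L / κ := by rw [le_div_iff₀ hκ]; linarith
    have h3 : 51 * L / κ = 50 * L / κ + L / κ := by ring
    push_cast
    linarith
  have hdpos : (0 : ℝ) < d := lt_trans (by positivity) hd1
  have hdlog : Real.log (4 / α) < d * κ / 5 := by
    rw [div_lt_iff₀ hκ] at hd1
    have h1 : 4 / α = 2 ^ 11 * δ ^ (-9 : ℝ) := by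
      rw [hα, Real.rpow_neg hδ.le]; field_simp; norm_num
    rw [h1, Real.log_mul (by positivity) (hpos _).ne', Real.log_pow, Real.log_rpow hδ, hLδ]
    have := Real.log_two_lt_d9
    push_cast
    linarith
  have hd3 : (d : ℝ) ≤ 153 * δ ^ (-1 + 2 * μ - μ / 20) := by
    refine hd2.trans ?_
    rw [div_le_iff₀ hκ]
    have h1 : 153 * δ ^ (-1 + 2 * μ - μ / 20) * κ = 51 * δ ^ (-(μ / 20)) := by
      rw [hκdef]
      have : δ ^ (-(μ / 20)) = δ ^ (-1 + 2 * μ - μ / 20) * δ ^ (1 - 2 * μ) := by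
        rw [hadd]; ring_nf
      rw [this]; ring
    rw [h1]; linarith
  -- Since `κDθ² ≥ 1/3`, about `16 · 3 = 48` times `sθ²` rounds suffice; rounding up adds one.
  obtain ⟨n, hn1, hn2⟩ : ∃ n : ℕ, s ≤ n * (κ * D / 16) ∧ (n : ℝ) ≤ 49 * δ ^ (-(μ / 2)) := by
    refine ⟨⌈s / (κ * D / 16)⌉₊, ?_, ?_⟩
    · rw [← div_le_iff₀ (by positivity)]; exact Nat.le_ceil _
    · have h1 := (Nat.ceil_lt_add_one (show 0 ≤ s / (κ * D / 16) by positivity)).le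
      have h2 : 1 ≤ δ ^ (-(μ / 2)) :=
        Real.one_le_rpow_of_pos_of_le_one_of_nonpos hδ hδ1.le (by linarith)
      have h3 : s / (κ * D / 16) ≤ 48 * δ ^ (-(μ / 2)) := by
        rw [div_le_iff₀ (by positivity)]
        refine le_of_mul_le_mul_right ?_ (show 0 < θ ^ 2 by positivity)
        have h4 : δ ^ (1 - 2 * μ) * δ ^ (2 * μ - 1) = 1 := by
          rw [hadd]; ring_nf; exact Real.rpow_zero δ
        calc s * θ ^ 2 = δ ^ (-(μ / 2)) * (δ ^ (1 - 2 * μ) * δ ^ (2 * μ - 1)) := by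
              rw [h4, hsθ, mul_one]
          _ ≤ δ ^ (-(μ / 2)) * (δ ^ (1 - 2 * μ) * (D * θ ^ 2)) := by gcongr
          _ = _ := by rw [hκdef]; ring
      linarith
  obtain ⟨Γ, U, hUΔ, hΓ, hspan, hor⟩ :=
    exists_small_spanning_set hκ hκ1 hαpos hspos hdlog hsΔ hEs hEκ hEα n
  have hUs : s ≤ #U := hor.elim id hn1.trans
  -- Even the doubled radius `1/(6d)` keeps sums of `d` terms within `1/6`.
  obtain ⟨γ, hγ1, hγ2, hreg⟩ := exists_isRegularBohr Γ (γ₀ := 1 / (12 * d)) (by positivity)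
  have hγpos : 0 < γ := lt_of_lt_of_le (by positivity) hγ1
  have hdγ : d * γ ≤ 1 / 6 := by
    calc d * γ ≤ d * (2 * (1 / (12 * d))) := by gcongr
      _ = 1 / 6 := by field_simp; norm_num
  have hd1' : (1 : ℝ) ≤ d := by
    have : 0 < d := by exact_mod_cast hdpos
    exact_mod_cast this
  refine ⟨Γ, γ, hγpos, by nlinarith, hreg, ?_, ?_, ?_⟩
  · calc (#Γ : ℝ) ≤ n * d := by exact_mod_cast hΓ
      _ ≤ 49 * δ ^ (-(μ / 2)) * (153 * δ ^ (-1 + 2 * μ - μ / 20)) := by gcongr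
      _ = 7497 * (δ ^ (-(μ / 2)) * δ ^ (-1 + 2 * μ - μ / 20)) := by ring
      _ ≤ 7500 * δ ^ (-1 + μ / 2) := by
          rw [hadd]
          have h1 : δ ^ (-(μ / 2) + (-1 + 2 * μ - μ / 20)) ≤ δ ^ (-1 + μ / 2) :=
            hmono (by linarith)
          have h2 := hpos (-1 + μ / 2)
          linarith
  · refine le_trans ?_ hγ1
    rw [le_div_iff₀ (by positivity)]
    have h1 : δ ^ (1 - μ / 2) * δ ^ (-1 + 2 * μ - μ / 20) ≤ 1 := by
      rw [hadd]; exact Real.rpow_le_one hδ.le hδ1.le (by linarith)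
    have h2 : δ ^ (1 - μ / 2) * d ≤ δ ^ (1 - μ / 2) * (153 * δ ^ (-1 + 2 * μ - μ / 20)) :=
      mul_le_mul_of_nonneg_left hd3 (hpos _).le
    linarith
  · have hB : (bohrSet Γ γ).Nonempty := card_pos.1 (card_bohrSet_pos Γ hγpos.le)
    obtain ⟨t, ht⟩ := exists_dense_translate hθ.le hA hB hUΔ (fun r hr => by
      refine half_card_le_norm_expSum fun y hy => ?_
      obtain ⟨l, hl, hlΓ, hlr⟩ := hspan r hr
      have hy' := (mem_filter.1 hy).2
      refine (norm_toAddCircle_mul_le_of_isSignedSum hlr fun a ha => hy' a (hlΓ a ha)).trans ?_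
      refine le_trans ?_ hdγ
      gcongr)
    refine ⟨t, ?_⟩
    set h : ℝ := (#((A.image fun a => a + t) ∩ bohrSet Γ γ) : ℝ)
    rw [hAδ] at ht
    have h1 : δ ^ (1 - μ / 2) = s * θ ^ 2 * δ := by
      rw [hsθ]; nth_rewrite 3 [← hδself]; rw [hadd]; ring_nf
    have h2 : s * θ ^ 2 * (δ * N) * #(bohrSet Γ γ) ≤ 4 * N * h := le_trans (by gcongr) ht
    have h3 : δ ^ (1 - μ / 2) * #(bohrSet Γ γ) ≤ 4 * h := by
      rw [h1]
      refine le_of_mul_le_mul_right ?_ hN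
      linarith
    have h4 : 0 ≤ δ ^ (1 - μ / 2) * #(bohrSet Γ γ) := mul_nonneg (hpos _).le (Nat.cast_nonneg _)
    linarith

theorem lemmal :
    ∃ μ₀ C c : ℝ, 0 < μ₀ ∧ 0 < C ∧ 0 < c ∧
      ∀ (μ : ℝ), 0 < μ → μ ≤ μ₀ →
      ∀ (N : ℕ) [NeZero N] (A : Finset (ZMod N)) (δ θ : ℝ),
        A.Nonempty →
        (#A : ℝ) = δ * (N : ℝ) →
        δ ^ (μ / 20) * Real.log (1 / δ) < 1 →
        δ ^ (1 + μ) ≤ θ →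
        θ ≤ δ ^ (1 - μ) →
        δ ^ (2 * μ) * θ ^ (-2 : ℝ) * δ ^ (-1 : ℝ) ≤ (#(largeSpectrum A θ) : ℝ) →
        δ ^ (-20 * μ) * θ ^ 8 * δ * (#(largeSpectrum A θ) : ℝ) ^ 8
          ≤ (higherEnergy 4 (largeSpectrum A θ) : ℝ) →
        ∃ (Γ : Finset (ZMod N)) (γ : ℝ),
          0 < γ ∧ γ ≤ 1 / 2 ∧
          IsRegularBohr Γ γ ∧
          (#Γ : ℝ) ≤ C * δ ^ (-1 + μ / 2) ∧
          c * δ ^ (1 - μ / 2) ≤ γ ∧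
          ∃ t : ZMod N,
            c * δ ^ (1 - μ / 2) * (#(bohrSet Γ γ) : ℝ)
              ≤ (#((A.image fun a => a + t) ∩ bohrSet Γ γ) : ℝ) := by
  refine ⟨1 / 100, 7500, 1 / 2000, by norm_num, by norm_num, by norm_num, ?_⟩
  intro μ hμ hμ1 N _ A δ θ hA hAδ hlog hθ1 _ hD hE
  have hN : (0 : ℝ) < N := by exact_mod_cast NeZero.pos N
  have hA' : (0 : ℝ) < #A := by exact_mod_cast hA.card_pos
  have hδ : 0 < δ := pos_of_mul_pos_left (hAδ ▸ hA') hN.le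
  -- If `δ ≥ exp (-20)`, then `δ ^ (-μ/2)` is bounded and the whole group, the Bohr set of rank 0,
  -- works.
  rcases lt_or_ge 20 (Real.log (1 / δ)) with hL | hL
  · exact exists_regular_bohrSet_of_small_density hμ hμ1 hA hAδ hδ hL hlog hθ1 hD hE
  have hδ1 : δ ≤ 1 := by
    have h1 : (#A : ℝ) ≤ N := by
      have := card_le_univ A
      rw [ZMod.card] at this
      exact_mod_cast this
    rw [hAδ] at h1
    exact le_of_mul_le_mul_right (by linarith) hN
  have h1 : δ ^ (1 - μ / 2) ≤ 1 := Real.rpow_le_one hδ.le hδ1 (by linarith)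
  refine ⟨∅, 1 / 2, by norm_num, le_rfl, isRegularBohr_empty _, ?_, by linarith, 0, ?_⟩
  · rw [card_empty, Nat.cast_zero]; positivity
  · simp only [bohrSet_empty, add_zero, image_id', inter_univ, card_univ, ZMod.card]
    rw [hAδ]
    refine mul_le_mul_of_nonneg_right ?_ hN.le
    have h2 : δ ^ (1 - μ / 2) = δ * δ ^ (-(μ / 2)) := by
      rw [sub_eq_add_neg, Real.rpow_add hδ, Real.rpow_one]
    have h3 : δ ^ (-(μ / 2)) ≤ 3 := by
      rw [Real.rpow_def_of_pos hδ]
      rw [one_div, Real.log_inv] at hL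
      have : Real.log δ * -(μ / 2) ≤ 1 := by nlinarith
      exact (Real.exp_le_exp.2 this).trans (by linarith [Real.exp_one_lt_d9])
    rw [h2]
    nlinarith
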